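/- Let $G$ be a finite connected simple graph with at least one edge, with maximum vertex degree $\Delta(G)$, and let $\Phi=(G,\varphi)$ be a $\mathbb{T}$-gain graph on $G$, i.e. $\varphi$ assigns to each oriented edge $\overrightarrow{e_{p,q}}$ of $G$ (each edge being taken in both orientations) a complex number of modulus $1$ with $\varphi(\overrightarrow{e_{q,p}})=\varphi(\overrightarrow{e_{p,q}})^{-1}$. Let $A(\Phi)$ be the Hermitian matrix with $(p,q)$ entry $\varphi(\overrightarrow{e_{p,q}})$ if $v_p\sim v_q$ and $0$ otherwise, let $|A(\Phi)|=(A(\Phi)A(\Phi)^*)^{1/2}$ (positive semidefinite square root), and let $\mathcal{E}_\Phi(v_i)=|A(\Phi)|_{ii}$ be the energy of the vertex $v_i$, whose degree is $d_i$. Then $$\mathcal{E}_\Phi(v_i)\ \ge\ \frac{d_i}{\Delta(G)}\qquad\text{for every vertex } v_i .$$ Moreover, for each vertex $v_i$, equality $\mathcal{E}_\Phi(v_i)=d_i/\Delta(G)$ holds if and only if $\Phi\sim(K_{d,d},1)$ for some $d$; that is, for some $d$ there is an isomorphism of $G$ with the complete bipartite graph $K_{d,d}$ under which $\Phi$ is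 switching equivalent to the gain graph all of whose gains are $1$. (In particular, equality holds at one vertex if and only if it holds at every vertex.) Here two $\mathbb{T}$-gain graphs $\Phi,\Phi'$ on the same graph are switching equivalent if $A(\Phi')=UA(\Phi)U^*$ for some unitary diagonal matrix $U$. -/

import Mathlib

open scoped MatrixOrder ComplexOrder

/-- A complex unit gain function on a simple graph `G`: a map from the oriented edges (darts) of `G`
to the unit circle whose value on a reversed oriented edge is the inverse.
The pair of `G` and a `UnitGain G` is a `𝕋`-gain graph. -/
structure UnitGain {V : Type*} (G : SimpleGraph V) where
  /-- the gain of an oriented edge -/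
  gain : G.Dart → Circle
  gain_symm : ∀ d : G.Dart, gain d.symm = (gain d)⁻¹

namespace UnitGain

/-- The adjacency matrix `A(Φ)` of the gain graph `Φ = (G, φ)`. -/
noncomputable def adjMatrix {V : Type*} {G : SimpleGraph V} [DecidableRel G.Adj]
    (φ : UnitGain G) : Matrix V V ℂ :=
  Matrix.of fun p q => if h : G.Adj p q then (φ.gain ⟨(p, q), h⟩ : ℂ) else 0

theorem adjMatrix_isHermitian {V : Type*} {G : SimpleGraph V} [DecidableRel G.Adj]
    (φ : UnitGain G) : φ.adjMatrix.IsHermitian := by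
  ext p q
  by_cases h : G.Adj p q
  · have hs : φ.gain ⟨(q, p), h.symm⟩ = (φ.gain ⟨(p, q), h⟩)⁻¹ := φ.gain_symm ⟨(p, q), h⟩
    simp only [adjMatrix, Matrix.conjTranspose_apply, Matrix.of_apply, h, h.symm, dif_pos, hs,
      Circle.coe_inv_eq_conj]
    exact star_star _
  · have h' : ¬ G.Adj q p := fun hq => h hq.symm
    simp [adjMatrix, Matrix.conjTranspose_apply, h, h']

/-- The constant gain `1`; `(G, 1)` is the underlying graph seen as a gain graph. -/
noncomputable def one {V : Type*} (G : SimpleGraph V) : UnitGain G where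
  gain _ := 1
  gain_symm _ := by simp

/-- Transport of a gain function along an identification of the underlying graphs. -/
def pullback {V W : Type*} {G : SimpleGraph V} {H : SimpleGraph W} (e : G ≃g H)
    (ψ : UnitGain H) : UnitGain G where
  gain d := ψ.gain (e.toHom.mapDart d)
  gain_symm d := ψ.gain_symm (e.toHom.mapDart d)

/-- Switching equivalence of two gain functions on the same graph:
`A(Φ') = U A(Φ) U*` for some unitary diagonal matrix `U`. -/
def SwitchingEquiv {V : Type*} [Fintype V] [DecidableEq V] {G : SimpleGraph V}
    [DecidableRel G.Adj] (φ φ' : UnitGain G) : Prop :=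
  ∃ U : Matrix V V ℂ, U.IsDiag ∧ U ∈ Matrix.unitaryGroup V ℂ ∧
    φ'.adjMatrix = U * φ.adjMatrix * U.conjTranspose

/-- `Φ ∼ Ψ` for gain graphs on possibly different vertex sets: after an identification of the two
underlying graphs, `Φ` and `Ψ` are switching equivalent. -/
def SwitchingIso {V W : Type*} [Fintype V] [DecidableEq V] {G : SimpleGraph V}
    [DecidableRel G.Adj] {H : SimpleGraph W} (φ : UnitGain G) (ψ : UnitGain H) : Prop :=
  ∃ e : G ≃g H, SwitchingEquiv φ (ψ.pullback e)

/-- `|A(Φ)| = (A(Φ) A(Φ)*)^{1/2}`, with the positive semidefinite square root. -/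
noncomputable def absAdjMatrix {V : Type*} [Fintype V] [DecidableEq V] {G : SimpleGraph V}
    [DecidableRel G.Adj] (φ : UnitGain G) : Matrix V V ℂ :=
  CFC.sqrt (φ.adjMatrix * φ.adjMatrix.conjTranspose)

theorem absAdjMatrix_posSemidef {V : Type*} [Fintype V] [DecidableEq V] {G : SimpleGraph V}
    [DecidableRel G.Adj] (φ : UnitGain G) : φ.absAdjMatrix.PosSemidef :=
  Matrix.nonneg_iff_posSemidef.mp (CFC.sqrt_nonneg _)

theorem absAdjMatrix_mul_self {V : Type*} [Fintype V] [DecidableEq V] {G : SimpleGraph V}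
    [DecidableRel G.Adj] (φ : UnitGain G) :
    φ.absAdjMatrix * φ.absAdjMatrix = φ.adjMatrix * φ.adjMatrix.conjTranspose :=
  CFC.sqrt_mul_sqrt_self _
    (Matrix.nonneg_iff_posSemidef.mpr (Matrix.posSemidef_self_mul_conjTranspose φ.adjMatrix))

/-- The energy of the vertex `i`: the diagonal entry `|A(Φ)|_{ii}`, which is a real number
(see `coe_vertexEnergy`). -/
noncomputable def vertexEnergy {V : Type*} [Fintype V] [DecidableEq V] {G : SimpleGraph V}
    [DecidableRel G.Adj] (φ : UnitGain G) (i : V) : ℝ :=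
  (φ.absAdjMatrix i i).re

theorem coe_vertexEnergy {V : Type*} [Fintype V] [DecidableEq V] {G : SimpleGraph V}
    [DecidableRel G.Adj] (φ : UnitGain G) (i : V) :
    (φ.vertexEnergy i : ℂ) = φ.absAdjMatrix i i :=
  φ.absAdjMatrix_posSemidef.isHermitian.coe_re_apply_self i

end UnitGain

/-!
Every row of `A = A(Φ)` has absolute sum at most `Δ`, so the spectrum of `A` lies in `[-Δ, Δ]` and
`A² ≤ Δ|A|`; the inequality compares the diagonal entries of the two sides.

Equality at `i` forces `(Δ|A| - A²) eᵢ = 0`, because `Δ|A| - A²` is positive semidefinite, and then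
`A³ eᵢ = Δ² A eᵢ`. For a neighbour `j` of `i`, the `(j, i)` entry of `A³` is a sum over the
`dⱼ dᵢ ≤ Δ²` pairs `(k, l)` with `k ∼ j` and `l ∼ i`, of terms of modulus at most `1`, whereas it
equals `Δ²` times the unit number `A j i`. Hence `dⱼ = dᵢ = Δ` and every term is `A j i`: all
neighbours of `j` are joined to all neighbours of `i`, which by connectedness makes `G` a `K_{Δ,Δ}`,
and the gains along all these walks agree, which is what is needed to switch them to `1`.
Conversely, the gain graph `(K_{d,d}, 1)` satisfies `A³ = d² A`, so `|A| = d⁻¹ A²`.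
-/

open Finset Matrix

section SelfAdjointAbs

variable {𝓐 : Type*} [Ring 𝓐] [StarRing 𝓐] [TopologicalSpace 𝓐] [Algebra ℝ 𝓐]
  [ContinuousFunctionalCalculus ℝ 𝓐 IsSelfAdjoint] [PartialOrder 𝓐] [StarOrderedRing 𝓐]
  [NonnegSpectrumClass ℝ 𝓐] [IsTopologicalRing 𝓐] [T2Space 𝓐] {a : 𝓐} {r : ℝ}

theorem sq_le_smul_cfcAbs (ha : IsSelfAdjoint a) (hr : ∀ t ∈ spectrum ℝ a, |t| ≤ r) :
    a ^ 2 ≤ r • CFC.abs a := by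
  rw [CFC.abs_eq_cfc_norm a, ← cfc_const_mul r _ a, ← cfc_pow_id (R := ℝ) a 2]
  refine cfc_mono fun t ht => ?_
  calc t ^ 2 = |t| * ‖t‖ := by rw [Real.norm_eq_abs, abs_mul_abs_self, sq]
    _ ≤ r * ‖t‖ := by gcongr; exact hr t ht

theorem cfcAbs_eq_inv_smul_sq_of_pow_three_eq [PosSMulMono ℝ 𝓐] (ha : IsSelfAdjoint a) (hr : 0 < r)
    (h : a ^ 3 = r ^ 2 • a) : CFC.abs a = r⁻¹ • a ^ 2 := by
  refine CFC.sqrt_unique ?_ (smul_nonneg (inv_nonneg.mpr hr.le) ha.sq_nonneg)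
  calc r⁻¹ • a ^ 2 * r⁻¹ • a ^ 2 = (r⁻¹ * r⁻¹) • (a ^ 3 * a) := by
        rw [smul_mul_smul_comm, ← pow_add, ← pow_succ]
    _ = (r⁻¹ * r⁻¹ * r ^ 2) • (a * a) := by rw [h, smul_mul_assoc, smul_smul]
    _ = star a * a := by rw [ha.star_eq]; field_simp; rw [one_smul]

end SelfAdjointAbs

section Matrix

variable {n : Type*} [Fintype n] [DecidableEq n]

theorem norm_le_of_mem_spectrum_of_row_sum_le {K : Type*} [NormedField K] {A : Matrix n n K}
    {r : ℝ} (hrow : ∀ p, ∑ q, ‖A p q‖ ≤ r) {μ : K} (hμ : μ ∈ spectrum K A) : ‖μ‖ ≤ r := by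
  rw [← spectrum_toLin', ← Module.End.hasEigenvalue_iff_mem_spectrum] at hμ
  obtain ⟨k, hk⟩ := eigenvalue_mem_ball hμ
  calc ‖μ‖ ≤ ‖A k k‖ + ‖μ - A k k‖ := norm_le_norm_add_norm_sub' μ (A k k)
    _ ≤ ‖A k k‖ + ∑ j ∈ univ.erase k, ‖A k j‖ := by gcongr; exact mem_closedBall_iff_norm.mp hk
    _ = ∑ j, ‖A k j‖ := add_sum_erase _ (fun j => ‖A k j‖) (mem_univ k)
    _ ≤ r := hrow k

theorem sq_le_smul_cfcAbs_of_row_sum_le {𝕜 : Type*} [RCLike 𝕜] {A : Matrix n n 𝕜}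
    (hA : A.IsHermitian) {r : ℝ} (hrow : ∀ p, ∑ q, ‖A p q‖ ≤ r) : A ^ 2 ≤ r • CFC.abs A :=
  sq_le_smul_cfcAbs hA fun t ht => by
    simpa using norm_le_of_mem_spectrum_of_row_sum_le hrow (spectrum.algebraMap_mem 𝕜 ht)

theorem mulVec_single_eq_of_le_of_diag_eq {𝕜 : Type*} [RCLike 𝕜] {A B : Matrix n n 𝕜}
    (h : A ≤ B) {i : n} (hi : A i i = B i i) : B *ᵥ Pi.single i 1 = A *ᵥ Pi.single i 1 := by
  rw [← sub_eq_zero, ← sub_mulVec, ← (le_iff.mp h).dotProduct_mulVec_zero_iff]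
  simp [hi]

theorem pow_three_mulVec_eq_of_smul_mulVec_eq {R : Type*} [CommRing R] [PartialOrder R]
    [StarRing R] [StarOrderedRing R] [NoZeroDivisors R] {A P : Matrix n n R} (hA : A.IsHermitian)
    (hP : P ^ 2 = A ^ 2) {c : R} {v : n → R} (h : c • P *ᵥ v = A ^ 2 *ᵥ v) :
    A ^ 3 *ᵥ v = c ^ 2 • A *ᵥ v := by
  have hcomm : A ^ 2 * P = P * A ^ 2 := by rw [← hP, ← pow_succ, ← pow_succ']
  have hfour : A ^ 2 *ᵥ A ^ 2 *ᵥ v = c ^ 2 • A ^ 2 *ᵥ v := calc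
    A ^ 2 *ᵥ A ^ 2 *ᵥ v = c • P *ᵥ A ^ 2 *ᵥ v := by
      conv_lhs => rw [← h]
      rw [mulVec_smul, mulVec_mulVec, hcomm, ← mulVec_mulVec]
    _ = c ^ 2 • A ^ 2 *ᵥ v := by
      conv_lhs => rw [← h]
      rw [mulVec_smul, mulVec_mulVec, ← sq, hP, smul_smul, ← sq]
  have hker : (Aᴴ * A) *ᵥ (A ^ 2 *ᵥ v - c ^ 2 • v) = 0 := by
    rw [hA.eq, ← sq, mulVec_sub, hfour, mulVec_smul, sub_self]
  rwa [conjTranspose_mul_self_mulVec_eq_zero, mulVec_sub, mulVec_mulVec, mulVec_smul,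
    ← pow_succ', sub_eq_zero] at hker

end Matrix

section InnerProductSpace

variable {ι E : Type*} [NormedAddCommGroup E] [InnerProductSpace ℝ E] {s : Finset ι}
  {z : ι → E} {w : E} {c : ℝ}

theorem eq_of_sum_eq_smul_of_norm_le (hz : ∀ x ∈ s, ‖z x‖ ≤ ‖w‖) (hc : #s ≤ c)
    (hsum : ∑ x ∈ s, z x = c • w) {x : ι} (hx : x ∈ s) : z x = w := by
  have hinner_le : ∀ y ∈ s, inner ℝ (z y) w ≤ ‖w‖ ^ 2 := fun y hy =>
    (real_inner_le_norm _ _).trans (by rw [sq]; gcongr; exact hz y hy)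
  have hinner_sum : ∑ y ∈ s, inner ℝ (z y) w = ∑ _y ∈ s, ‖w‖ ^ 2 := by
    refine le_antisymm (sum_le_sum hinner_le) ?_
    rw [← sum_inner, hsum, real_inner_smul_left, real_inner_self_eq_norm_sq, sum_const,
      nsmul_eq_mul]
    gcongr
  have hinner : inner ℝ (z x) w = ‖w‖ ^ 2 := (sum_eq_sum_iff_of_le hinner_le).mp hinner_sum x hx
  have hsub : ‖z x - w‖ ^ 2 ≤ 0 := by
    rw [norm_sub_sq_real, hinner]
    linarith [pow_le_pow_left₀ (norm_nonneg _) (hz x hx) 2]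
  exact sub_eq_zero.mp (norm_eq_zero.mp (pow_eq_zero_iff two_ne_zero |>.mp
    (le_antisymm hsub (by positivity))))

theorem card_eq_of_sum_eq_smul_of_norm_le (hw : w ≠ 0) (hz : ∀ x ∈ s, ‖z x‖ ≤ ‖w‖) (hc : #s ≤ c)
    (hsum : ∑ x ∈ s, z x = c • w) : #s = c := by
  refine smul_left_injective ℝ hw ?_
  simp only [← hsum, sum_congr rfl fun _ hx => eq_of_sum_eq_smul_of_norm_le hz hc hsum hx,
    sum_const, Nat.cast_smul_eq_nsmul]

end InnerProductSpace

section Graph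

variable {V : Type*} {G : SimpleGraph V}

theorem neighborFinset_eq_of_isCompleteBetween {s : Set V} {t : Finset V}
    (h : G.IsCompleteBetween s t) {k : V} [Fintype (G.neighborSet k)] (hk : k ∈ s)
    (hdeg : G.degree k ≤ #t) : G.neighborFinset k = t :=
  (eq_of_subset_of_card_le (fun _ hl => (G.mem_neighborFinset k _).mpr (h hk hl)) hdeg).symm

theorem eq_compl_of_neighborSet_eq {s t : Set V} (hG : G.Preconnected) (hs : s.Nonempty)
    (hst : ∀ k ∈ s, G.neighborSet k = t) (hts : ∀ l ∈ t, G.neighborSet l = s) : t = sᶜ := by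
  have hdisj : ∀ k ∈ s, k ∉ t := fun k hk hkt => by
    rw [← hst k hk] at hkt
    exact G.irrefl hkt
  have hclosed : ∀ p q, G.Adj p q → p ∈ s ∪ t → q ∈ s ∪ t := by
    rintro p q hpq (hp | hp)
    · exact .inr (hst p hp ▸ hpq)
    · exact .inl (hts p hp ▸ hpq)
  have hcover : s ∪ t = Set.univ := by
    obtain ⟨x, hx⟩ := hs
    by_contra! hne
    obtain ⟨y, hy⟩ := (Set.ne_univ_iff_exists_notMem _).mp hne
    obtain ⟨d, -, hd, hd'⟩ := (hG x y).some.exists_boundary_dart (s ∪ t) (.inl hx) hy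
    exact hd' (hclosed _ _ d.adj hd)
  exact (IsCompl.of_eq (Set.disjoint_left.mpr hdisj).inter_eq hcover).symm.eq_compl

theorem adj_iff_of_isCompleteBetween [G.LocallyFinite] {s t : Finset V} (hG : G.Preconnected)
    (hs : s.Nonempty) (h : G.IsCompleteBetween s t) (hdegs : ∀ k ∈ s, G.degree k ≤ #t)
    (hdegt : ∀ l ∈ t, G.degree l ≤ #s) (p q : V) : G.Adj p q ↔ (p ∈ s ↔ q ∉ s) := by
  have hst : ∀ k ∈ s, G.neighborSet k = t := fun k hk => by
    rw [← neighborFinset_eq_of_isCompleteBetween h hk (hdegs k hk), G.coe_neighborFinset]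
  have hts : ∀ l ∈ t, G.neighborSet l = s := fun l hl => by
    rw [← neighborFinset_eq_of_isCompleteBetween h.symm hl (hdegt l hl), G.coe_neighborFinset]
  have ht := Set.ext_iff.mp (eq_compl_of_neighborSet_eq hG hs hst hts)
  rw [← G.mem_neighborSet]
  by_cases hp : p ∈ s
  · simp [hst p hp, hp, ht q]
  · simp [hts p ((ht p).mpr hp), hp]

theorem nonempty_iso_completeBipartiteGraph_compl {s : Set V}
    (h : ∀ p q, G.Adj p q ↔ (p ∈ s ↔ q ∉ s)) :
    Nonempty (G ≃g completeBipartiteGraph s ↥sᶜ) := by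
  classical
  refine ⟨RelIso.symm ⟨Equiv.Set.sumCompl s, ?_⟩⟩
  rintro (⟨x, hx⟩ | ⟨x, hx : x ∉ s⟩) (⟨y, hy⟩ | ⟨y, hy : y ∉ s⟩) <;> simp [h, hx, hy]

theorem nonempty_iso_completeBipartiteGraph_fin_degree [G.LocallyFinite] {i j : V}
    (hji : G.Adj j i) (h : ∀ p q, G.Adj p q ↔ (G.Adj j p ↔ ¬ G.Adj j q)) :
    Nonempty (G ≃g completeBipartiteGraph (Fin (G.degree j)) (Fin (G.degree i))) := by
  have hcompl : (G.neighborSet j)ᶜ = G.neighborSet i := by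
    ext p
    simp [h i p, hji]
  obtain ⟨e⟩ := nonempty_iso_completeBipartiteGraph_compl (s := G.neighborSet j) h
  rw [hcompl] at e
  exact ⟨e.trans (SimpleGraph.completeBipartiteGraphCongr
    (Fintype.equivFinOfCardEq (G.card_neighborSet_eq_degree j))
    (Fintype.equivFinOfCardEq (G.card_neighborSet_eq_degree i)))⟩

theorem pow_three_adjMatrix_completeBipartiteGraph {R W : Type*} [Semiring R]
    [Fintype V] [Fintype W] [DecidableEq V] [DecidableEq W]
    [DecidableRel (completeBipartiteGraph V W).Adj] :
    (completeBipartiteGraph V W).adjMatrix R ^ 3 =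
      (Fintype.card V * Fintype.card W) • (completeBipartiteGraph V W).adjMatrix R := by
  have hblocks : (completeBipartiteGraph V W).adjMatrix R =
      fromBlocks 0 (of fun _ _ => 1) (of fun _ _ => 1) 0 := by
    ext (_ | _) (_ | _) <;> simp
  rw [hblocks, pow_three, fromBlocks_multiply, fromBlocks_multiply, fromBlocks_smul]
  have hcomm := (Nat.cast_commute (Fintype.card V) (Fintype.card W : R)).eq
  ext (_ | _) (_ | _) <;> simp [mul_apply, hcomm]

theorem pow_three_adjMatrix_of_iso_completeBipartiteGraph {R X Y : Type*} [Semiring R]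
    [Fintype V] [DecidableEq V] [DecidableRel G.Adj] [Fintype X] [Fintype Y]
    (e : G ≃g completeBipartiteGraph X Y) :
    G.adjMatrix R ^ 3 = (Fintype.card X * Fintype.card Y) • G.adjMatrix R := by
  classical
  apply (reindexAlgEquiv ℕ R (e : V ≃ X ⊕ Y)).injective
  rw [map_pow, map_nsmul, coe_reindexAlgEquiv, e.reindex_adjMatrix R]
  exact pow_three_adjMatrix_completeBipartiteGraph

theorem isRegularOfDegree_of_iso_completeBipartiteGraph [G.LocallyFinite] {X Y : Type*}
    [Fintype X] [Fintype Y] (e : G ≃g completeBipartiteGraph X Y)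
    (hXY : Fintype.card X = Fintype.card Y) : G.IsRegularOfDegree (Fintype.card X) := by
  classical
  intro p
  rw [← e.degree_eq p, ← SimpleGraph.card_neighborFinset_eq_degree,
    SimpleGraph.neighborFinset_eq_filter, card_filter, Fintype.sum_sum_type]
  rcases e p <;> simp [hXY]

end Graph

namespace UnitGain

section Entries

variable {V : Type*} {G : SimpleGraph V} [DecidableRel G.Adj] (φ : UnitGain G) {p q : V}

theorem adjMatrix_apply_of_not_adj (h : ¬ G.Adj p q) : φ.adjMatrix p q = 0 := by
  simp [adjMatrix, h]

theorem norm_adjMatrix_apply (p q : V) : ‖φ.adjMatrix p q‖ = if G.Adj p q then 1 else 0 := by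
  by_cases h : G.Adj p q <;> simp [adjMatrix, h, Circle.norm_coe]

theorem norm_adjMatrix_apply_of_adj (h : G.Adj p q) : ‖φ.adjMatrix p q‖ = 1 := by
  rw [norm_adjMatrix_apply, if_pos h]

theorem norm_adjMatrix_apply_le_one (p q : V) : ‖φ.adjMatrix p q‖ ≤ 1 := by
  rw [norm_adjMatrix_apply]
  split_ifs <;> norm_num

theorem norm_walk_le_norm_of_adj {i j : V} (hji : G.Adj j i) (k l : V) :
    ‖φ.adjMatrix j k * φ.adjMatrix k l * φ.adjMatrix l i‖ ≤ ‖φ.adjMatrix j i‖ := by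
  rw [norm_mul, norm_mul, φ.norm_adjMatrix_apply_of_adj hji]
  exact mul_le_one₀ (mul_le_one₀ (φ.norm_adjMatrix_apply_le_one _ _) (norm_nonneg _)
    (φ.norm_adjMatrix_apply_le_one _ _)) (norm_nonneg _) (φ.norm_adjMatrix_apply_le_one _ _)

theorem star_adjMatrix_apply (p q : V) : star (φ.adjMatrix p q) = φ.adjMatrix q p :=
  φ.adjMatrix_isHermitian.apply q p

theorem adjMatrix_apply_mul_apply_swap (p q : V) :
    φ.adjMatrix p q * φ.adjMatrix q p = if G.Adj p q then 1 else 0 := by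
  rw [← φ.star_adjMatrix_apply p q, Complex.star_def, Complex.mul_conj', norm_adjMatrix_apply]
  split_ifs <;> simp

theorem adjMatrix_one : (one G).adjMatrix = G.adjMatrix ℂ := by
  ext p q
  simp [adjMatrix, one, SimpleGraph.adjMatrix_apply]

variable [Fintype V]

theorem sum_norm_adjMatrix_apply (p : V) : ∑ q, ‖φ.adjMatrix p q‖ = G.degree p := by
  simp only [norm_adjMatrix_apply, G.degree_eq_sum_if_adj p]

theorem adjMatrix_sq_apply_self [DecidableEq V] (p : V) :
    (φ.adjMatrix ^ 2) p p = G.degree p := by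
  simp only [sq, mul_apply, adjMatrix_apply_mul_apply_swap, G.degree_eq_sum_if_adj p]

theorem pow_three_adjMatrix_apply [DecidableEq V] (j i : V) :
    (φ.adjMatrix ^ 3) j i = ∑ x ∈ G.neighborFinset j ×ˢ G.neighborFinset i,
      φ.adjMatrix j x.1 * φ.adjMatrix x.1 x.2 * φ.adjMatrix x.2 i := by
  have hsum : (φ.adjMatrix ^ 3) j i =
      ∑ x : V × V, φ.adjMatrix j x.1 * φ.adjMatrix x.1 x.2 * φ.adjMatrix x.2 i := by
    simp only [pow_three, mul_apply, mul_sum, Fintype.sum_prod_type, mul_assoc]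
  rw [hsum, eq_comm]
  refine sum_subset (subset_univ _) fun x _ hx => ?_
  rw [mem_product, G.mem_neighborFinset, G.mem_neighborFinset, G.adj_comm i, not_and_or] at hx
  rcases hx with hx | hx <;> simp [φ.adjMatrix_apply_of_not_adj hx]

end Entries

section Energy

variable {V : Type*} [Fintype V] [DecidableEq V] {G : SimpleGraph V} [DecidableRel G.Adj]
  (φ : UnitGain G)

theorem absAdjMatrix_eq_cfcAbs : φ.absAdjMatrix = CFC.abs φ.adjMatrix := by
  rw [absAdjMatrix, CFC.abs, star_eq_conjTranspose, φ.adjMatrix_isHermitian.eq]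

theorem adjMatrix_sq_le : φ.adjMatrix ^ 2 ≤ (G.maxDegree : ℝ) • φ.absAdjMatrix := by
  rw [absAdjMatrix_eq_cfcAbs]
  refine sq_le_smul_cfcAbs_of_row_sum_le φ.adjMatrix_isHermitian fun p => ?_
  rw [sum_norm_adjMatrix_apply]
  exact_mod_cast G.degree_le_maxDegree p

theorem smul_absAdjMatrix_apply_self (r : ℝ) (i : V) :
    (r • φ.absAdjMatrix) i i = (r * φ.vertexEnergy i : ℝ) := by
  rw [Matrix.smul_apply, ← coe_vertexEnergy, Complex.real_smul, Complex.ofReal_mul]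

theorem degree_le_maxDegree_mul_vertexEnergy (i : V) :
    G.degree i ≤ G.maxDegree * φ.vertexEnergy i := by
  have hdiag := (le_iff.mp φ.adjMatrix_sq_le).diag_nonneg (i := i)
  rw [Matrix.sub_apply, smul_absAdjMatrix_apply_self, adjMatrix_sq_apply_self, sub_nonneg] at hdiag
  exact_mod_cast hdiag

theorem pow_three_adjMatrix_apply_of_vertexEnergy_eq {i : V}
    (h : G.degree i = G.maxDegree * φ.vertexEnergy i) (j : V) :
    (φ.adjMatrix ^ 3) j i = (G.maxDegree : ℝ) ^ 2 • φ.adjMatrix j i := by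
  have hdiag : (φ.adjMatrix ^ 2) i i = ((G.maxDegree : ℝ) • φ.absAdjMatrix) i i := by
    rw [adjMatrix_sq_apply_self, smul_absAdjMatrix_apply_self, ← h, Complex.ofReal_natCast]
  have hcol := mulVec_single_eq_of_le_of_diag_eq φ.adjMatrix_sq_le hdiag
  have hsq : φ.absAdjMatrix ^ 2 = φ.adjMatrix ^ 2 := by
    rw [sq, absAdjMatrix_mul_self, φ.adjMatrix_isHermitian.eq, sq]
  rw [smul_mulVec, ← Complex.coe_smul] at hcol
  have hcube := pow_three_mulVec_eq_of_smul_mulVec_eq φ.adjMatrix_isHermitian hsq hcol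
  simpa using congrFun hcube j

theorem vertexEnergy_eq_of_pow_three_eq {r : ℝ} (hr : 0 < r)
    (h : φ.adjMatrix ^ 3 = r ^ 2 • φ.adjMatrix) (i : V) : φ.vertexEnergy i = G.degree i / r := by
  rw [vertexEnergy, absAdjMatrix_eq_cfcAbs,
    cfcAbs_eq_inv_smul_sq_of_pow_three_eq φ.adjMatrix_isHermitian hr h, Matrix.smul_apply,
    adjMatrix_sq_apply_self, Complex.smul_re, Complex.natCast_re, smul_eq_mul, inv_mul_eq_div]

end Energy

section Walks

variable {V : Type*} {G : SimpleGraph V} [DecidableRel G.Adj] {φ : UnitGain G} {i j : V}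

theorem isCompleteBetween_neighborSet_of_walk_eq (hji : G.Adj j i)
    (hwalk : ∀ k l, G.Adj j k → G.Adj i l →
      φ.adjMatrix j k * φ.adjMatrix k l * φ.adjMatrix l i = φ.adjMatrix j i) :
    G.IsCompleteBetween (G.neighborSet j) (G.neighborSet i) := by
  intro k hk l hl
  by_contra hkl
  have hzero : φ.adjMatrix j i = 0 := by
    rw [← hwalk k l hk hl, φ.adjMatrix_apply_of_not_adj hkl, mul_zero, zero_mul]
  simpa [hzero] using φ.norm_adjMatrix_apply_of_adj hji

variable [Fintype V] [DecidableEq V] {c : ℝ}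

theorem degree_mul_degree_eq_of_pow_three_apply_eq (hji : G.Adj j i)
    (hc : G.degree j * G.degree i ≤ c) (h : (φ.adjMatrix ^ 3) j i = c • φ.adjMatrix j i) :
    G.degree j * G.degree i = c := by
  have hne : φ.adjMatrix j i ≠ 0 := norm_ne_zero_iff.mp (by simp [norm_adjMatrix_apply, hji])
  rw [pow_three_adjMatrix_apply] at h
  simpa using card_eq_of_sum_eq_smul_of_norm_le hne
    (fun x _ => φ.norm_walk_le_norm_of_adj hji x.1 x.2) (by simpa using hc) h

theorem walk_eq_of_pow_three_apply_eq (hji : G.Adj j i)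
    (hc : G.degree j * G.degree i ≤ c) (h : (φ.adjMatrix ^ 3) j i = c • φ.adjMatrix j i)
    {k l : V} (hk : G.Adj j k) (hl : G.Adj i l) :
    φ.adjMatrix j k * φ.adjMatrix k l * φ.adjMatrix l i = φ.adjMatrix j i := by
  rw [pow_three_adjMatrix_apply] at h
  exact eq_of_sum_eq_smul_of_norm_le (fun x _ => φ.norm_walk_le_norm_of_adj hji x.1 x.2)
    (by simpa using hc) h (x := (k, l)) (by simp [hk, hl])

end Walks

section Switching

variable {V : Type*} [Fintype V] [DecidableEq V] {G : SimpleGraph V} [DecidableRel G.Adj]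
  {φ ψ : UnitGain G}

theorem switchingEquiv_of_adjMatrix_apply_eq (u : V → ℂ) (hu : ∀ p, ‖u p‖ = 1)
    (h : ∀ p q, ψ.adjMatrix p q = u p * φ.adjMatrix p q * star (u q)) :
    SwitchingEquiv φ ψ := by
  refine ⟨diagonal u, isDiag_diagonal u, ?_, ?_⟩
  · rw [mem_unitaryGroup_iff, star_eq_conjTranspose, diagonal_conjTranspose,
      diagonal_mul_diagonal, diagonal_eq_one]
    ext p
    simp [Complex.mul_conj', hu p]
  · ext p q
    rw [diagonal_conjTranspose, mul_diagonal, diagonal_mul, h, Pi.star_apply]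

theorem switchingEquiv_one_of_walk_eq {i j : V} (hji : G.Adj j i)
    (hG : ∀ p q, G.Adj p q ↔ (G.Adj j p ↔ ¬ G.Adj j q))
    (hwalk : ∀ k l, G.Adj j k → G.Adj i l →
      φ.adjMatrix j k * φ.adjMatrix k l * φ.adjMatrix l i = φ.adjMatrix j i) :
    SwitchingEquiv φ (one G) := by
  set A := φ.adjMatrix
  have hswap {p q : V} (h : G.Adj p q) : A p q * A q p = 1 := by
    rw [φ.adjMatrix_apply_mul_apply_swap, if_pos h]
  have hnorm {p q : V} (h : G.Adj p q) : ‖A p q‖ = 1 := φ.norm_adjMatrix_apply_of_adj h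
  have hi {l : V} : G.Adj i l ↔ ¬ G.Adj j l := by simp [hG i l, hji]
  -- `u p` is the gain of a path from `i` to `p`, of length one or two.
  let u (p : V) : ℂ := if G.Adj j p then A i j * A j p else A i p
  have hedge (k l : V) (hk : G.Adj j k) (hl : ¬ G.Adj j l) : u k * A k l * star (u l) = 1 := by
    simp only [u, if_pos hk, if_neg hl, A, star_adjMatrix_apply]
    linear_combination A i j * hwalk k l hk (hi.mpr hl) + hswap hji.symm
  refine switchingEquiv_of_adjMatrix_apply_eq u (fun p => ?_) (fun p q => ?_)
  · by_cases hp : G.Adj j p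
    · simp [u, hp, hnorm hji.symm, hnorm hp]
    · simp [u, hp, hnorm (hi.mpr hp)]
  · rw [adjMatrix_one, SimpleGraph.adjMatrix_apply]
    split_ifs with hpq
    · by_cases hp : G.Adj j p
      · exact (hedge p q hp (((hG p q).mp hpq).mp hp)).symm
      · have hq : G.Adj j q := by_contra fun hq => hp (((hG p q).mp hpq).mpr hq)
        have hstar := congrArg star (hedge q p hq hp)
        rw [star_mul', star_mul', star_star, φ.star_adjMatrix_apply, star_one] at hstar
        linear_combination -hstar
    · simp [φ.adjMatrix_apply_of_not_adj hpq]

theorem SwitchingEquiv.pow_three_adjMatrix_eq (h : SwitchingEquiv φ ψ) {c : ℝ}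
    (hψ : ψ.adjMatrix ^ 3 = c • ψ.adjMatrix) : φ.adjMatrix ^ 3 = c • φ.adjMatrix := by
  obtain ⟨U, -, hU, h⟩ := h
  apply EquivLike.injective (Unitary.conjStarAlgAut ℝ (Matrix V V ℂ) ⟨U, hU⟩)
  have hconj : Unitary.conjStarAlgAut ℝ _ ⟨U, hU⟩ φ.adjMatrix = ψ.adjMatrix := h.symm
  rw [map_pow, map_smul, hconj, hψ]

theorem switchingIso_one_iff {W : Type*} {H : SimpleGraph W} :
    SwitchingIso φ (one H) ↔ Nonempty (G ≃g H) ∧ SwitchingEquiv φ (one G) :=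
  ⟨fun ⟨e, h⟩ => ⟨⟨e⟩, h⟩, fun ⟨⟨e⟩, h⟩ => ⟨e, h⟩⟩

theorem switchingIso_completeBipartiteGraph_of_pow_three_apply_eq (hG : G.Preconnected) {i j : V}
    (hji : G.Adj j i)
    (h : (φ.adjMatrix ^ 3) j i = (G.maxDegree : ℝ) ^ 2 • φ.adjMatrix j i) :
    SwitchingIso φ (one (completeBipartiteGraph (Fin G.maxDegree) (Fin G.maxDegree))) := by
  have hle : (G.degree j * G.degree i : ℝ) ≤ G.maxDegree ^ 2 := by
    rw [sq]
    gcongr <;> exact G.degree_le_maxDegree _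
  have hdeg : G.degree j = G.maxDegree ∧ G.degree i = G.maxDegree := by
    have hmul : G.degree j * G.degree i = G.maxDegree * G.maxDegree := by
      rw [← sq]
      exact_mod_cast degree_mul_degree_eq_of_pow_three_apply_eq hji hle h
    exact (mul_eq_mul_iff_eq_and_eq_of_pos (G.degree_le_maxDegree j) (G.degree_le_maxDegree i)
      hji.degree_pos_left (hji.degree_pos_left.trans_le (G.degree_le_maxDegree j))).mp hmul
  have hwalk (k l : V) (hk : G.Adj j k) (hl : G.Adj i l) :=
    walk_eq_of_pow_three_apply_eq hji hle h hk hl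
  have hcomplete : G.IsCompleteBetween (G.neighborFinset j) (G.neighborFinset i) := by
    simpa using isCompleteBetween_neighborSet_of_walk_eq hji hwalk
  have hadj : ∀ p q, G.Adj p q ↔ (G.Adj j p ↔ ¬ G.Adj j q) := by
    simpa using adj_iff_of_isCompleteBetween hG ⟨i, by simpa⟩ hcomplete
      (fun k _ => by simpa [hdeg] using G.degree_le_maxDegree k)
      (fun l _ => by simpa [hdeg] using G.degree_le_maxDegree l)
  obtain ⟨hj, hi⟩ := hdeg
  have hiso := nonempty_iso_completeBipartiteGraph_fin_degree hji hadj
  rw [hj, hi] at hiso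
  exact switchingIso_one_iff.mpr ⟨hiso, switchingEquiv_one_of_walk_eq hji hadj hwalk⟩

theorem vertexEnergy_eq_of_switchingIso_completeBipartiteGraph {d : ℕ}
    (h : SwitchingIso φ (one (completeBipartiteGraph (Fin d) (Fin d)))) (i : V) :
    φ.vertexEnergy i = G.degree i / G.maxDegree := by
  have : Nonempty V := ⟨i⟩
  obtain ⟨⟨e⟩, hswitch⟩ := switchingIso_one_iff.mp h
  have hmax : G.maxDegree = d := by
    simpa using (isRegularOfDegree_of_iso_completeBipartiteGraph e rfl).maxDegree_eq
  have hd : 0 < d := by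
    rcases e i with a | a <;> exact a.pos
  have hcube : (one G).adjMatrix ^ 3 = (d : ℝ) ^ 2 • (one G).adjMatrix := by
    rw [adjMatrix_one, pow_three_adjMatrix_of_iso_completeBipartiteGraph e, Fintype.card_fin,
      ← Nat.cast_smul_eq_nsmul ℝ, Nat.cast_mul, sq]
  rw [hmax]
  exact φ.vertexEnergy_eq_of_pow_three_eq (Nat.cast_pos.mpr hd)
    (hswitch.pow_three_adjMatrix_eq hcube) i

end Switching

end UnitGain

theorem mainTheorem8 {V : Type*} [Fintype V] [DecidableEq V] (G : SimpleGraph V)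
    [DecidableRel G.Adj] (hconn : G.Connected) (hedge : G.edgeSet.Nonempty) (φ : UnitGain G) :
    (∀ i : V, (G.degree i : ℝ) / (G.maxDegree : ℝ) ≤ φ.vertexEnergy i) ∧
    (∀ i : V, φ.vertexEnergy i = (G.degree i : ℝ) / (G.maxDegree : ℝ) ↔
      ∃ d : ℕ, UnitGain.SwitchingIso φ
        (UnitGain.one (completeBipartiteGraph (Fin d) (Fin d)))) := by
  obtain ⟨a, b, hab⟩ :=
    SimpleGraph.ne_bot_iff_exists_adj.mp (SimpleGraph.edgeSet_nonempty.mp hedge)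
  have : Nontrivial V := ⟨a, b, hab.ne⟩
  have hΔ : (0 : ℝ) < G.maxDegree :=
    Nat.cast_pos.mpr (hab.degree_pos_left.trans_le (G.degree_le_maxDegree a))
  refine ⟨fun i => (div_le_iff₀' hΔ).mpr (φ.degree_le_maxDegree_mul_vertexEnergy i),
    fun i => ⟨?_, ?_⟩⟩
  · intro h
    have hi : (G.degree i : ℝ) = G.maxDegree * φ.vertexEnergy i := by
      rw [h, mul_div_cancel₀ _ hΔ.ne']
    obtain ⟨j, hij⟩ := hconn.preconnected.exists_adj_of_nontrivial i
    exact ⟨G.maxDegree, UnitGain.switchingIso_completeBipartiteGraph_of_pow_three_apply_eq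
      hconn.preconnected hij.symm (φ.pow_three_adjMatrix_apply_of_vertexEnergy_eq hi j)⟩
  · rintro ⟨d, hd⟩
    exact UnitGain.vertexEnergy_eq_of_switchingIso_completeBipartiteGraph hd i
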